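/- **Setting.** Let $\mu=dV$ be a Haar measure on $SL(2,\mathbb C)$. For $N\in\mathbb N$, $\rho\in\mathbb R$, realize the principal series representation $(N,\rho)$ on functions on $\mathbb C^2\setminus\{0\}$ (row vectors) with $f(cz)=|c|^{i\rho-2}(c/|c|)^{-N}f(z)$, action $(D^{N,\rho}(a)f)(z)=f(za)$ and inner product $\frac1\pi\int_{\mathbb C}\overline{f(w,1)}\,g(w,1)\,d^2w$. Its canonical orthonormal basis $|k,m\rangle$ ($k\in\frac N2+\mathbb N$, $m=-k,\dots,k$) consists of the functions given on unit vectors $z$ by $\sqrt{2k+1}\,D^k_{N/2,m}(u)$, where $D^k$ is the Wigner matrix and $u\in SU(2)$ has second row $z$. Put $D^{N,\rho}_{km,k'm'}(a)=\langle k,m|D^{N,\rho}(a)|k',m'\rangle$. Consider the complete graph on $\{1,\dots,5\}$ with an orientation of its ten links. Attach labels $(N_{(tt')},\rho_{(tt')})$ to the links, spins $k_{tt'}\in\frac12N_{(tt')}+\mathbb N$ to the pairs (node $t$, link $(tt')$), and to each node $t$ an arbitrary tensor $i_t$ in the four spins $k_{tt'}$ (for instance an $SU(2)$ intertwiner). For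 $U=(U_{tt'})$ let $$\Psi(U)=\sum_{\{m_{tt'}\}}\ \prod_t (i_t)_{\{m_{tt'}\}_{t'}}\ \prod_{t\to t'}D^{N_{(tt')},\rho_{(tt')}}_{k_{tt'}m_{tt'},\,k_{t't}m_{t't}}(U_{tt'}),$$ the last product being over the oriented links, and let $\tilde F(V_1,\dots,V_5)=\Psi\big((V_t^{-1}V_{t'})_{t\to t'}\big)$ be the integrand of the vertex amplitude. For a node $a$ and $g\in SL(2,\mathbb C)$ let $A_a(g)=\int\prod_{j\ne a}dV_j\ \tilde F(V)\big|_{V_a=g}$. Integrals of functions that are not absolutely integrable are assigned the value $0$. **Statement.** For all such labels: 1. $\mu$ is right invariant and $\mu(SL(2,\mathbb C))=\infty$. 2. Neither the absolute convergence of the integral defining $A_a(g)$, nor the value in $[0,\infty]$ of the corresponding integral of $|\tilde F|$, nor the value $A_a(g)$ depends on $g$ or on $a$: $A_a(g)=A_b(h)$ for all $a,b\in\{1,\dots,5\}$ and $g,h\in SL(2,\mathbb C)$. Denote the common value by $A^{\rm reg}$. 3. For every $a$, $A^{\rm reg}=\int\prod_{j\neq a}dV_j\ \Psi(U)$, where $U_{tt'}=V_t^{-1}V_{t'}$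 if $t,t'\ne a$, $U_{at'}=V_{t'}$ and $U_{ta}=V_t^{-1}$. 4. For every $a$ and every measurable $S$ with $\mu(S)<\infty$, $\int_{\{V_a\in S\}}\tilde F\,dV_1\cdots dV_5=\mu(S)\,A^{\rm reg}$; this integral converges absolutely if the four-fold one does. 5. For every $a$ and $g$, $\int|\tilde F|\,dV_1\cdots dV_5=\mu(SL(2,\mathbb C))\cdot\int\prod_{j\ne a}dV_j\,\big|\tilde F|_{V_a=g}\big|$ in $[0,\infty]$ (with $\infty\cdot0=0$). If $A^{\rm reg}\neq0$, then $\tilde F$ is not integrable over $SL(2,\mathbb C)^5$. -/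

import Mathlib

open MeasureTheory Matrix
open scoped Nat

/-- The group `SL(2,ℂ)`. -/
abbrev SL2C : Type := Matrix.SpecialLinearGroup (Fin 2) ℂ

/-! ### Principal series representations of `SL(2,ℂ)`

The principal series representation `(N, ρ)` acts on functions `f` on `ℂ² ∖ {0}` (row vectors) with
`f (c z) = |c| ^ (i ρ - 2) * (c / |c|) ^ (-N) * f z`, by `(D(a) f) z = f (z a)`; the invariant inner
product is `⟨f, g⟩ = (1/π) ∫_ℂ conj (f (w, 1)) * g (w, 1) d²w`.

Spins are stored as twice their value: `K = 2k`.  A magnetic number `m ∈ {-k, …, k}` is stored as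
`k + m ∈ {0, …, 2k}`. -/

/-- The action `D(a)` of `SL(2,ℂ)` on functions of a row vector. -/
def principalAction (a : SL2C) (f : (Fin 2 → ℂ) → ℂ) : (Fin 2 → ℂ) → ℂ :=
  fun z => f (z ᵥ* (a : Matrix (Fin 2) (Fin 2) ℂ))

/-- The invariant inner product on the representation space of the principal series. -/
noncomputable def principalInner (f g : (Fin 2 → ℂ) → ℂ) : ℂ :=
  (Real.pi : ℂ)⁻¹ * ∫ w : ℂ, (starRingEnd ℂ) (f ![w, 1]) * g ![w, 1]

/-- The Wigner matrix element `D^k_{q m}(u)` of the spin-`k` representation of `SU(2)`, as a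
polynomial in the entries of a `2 × 2` matrix `u`; here `K = 2k`, `s = k + q`, `r = k + m`.
It is the coefficient of `e_q` in `u · e_m`, for the basis
`e_m = x ^ (k+m) * y ^ (k-m) / √((k+m)! (k-m)!)` of the homogeneous polynomials of degree `2k` and
the action `(u · p) (x, y) = p ((x, y) u)`; below `y` is set to `1`. -/
noncomputable def wignerD (K s r : ℕ) (u : Matrix (Fin 2) (Fin 2) ℂ) : ℂ :=
  (Real.sqrt ((s ! * (K - s)! : ℝ) / (r ! * (K - r)! : ℝ)) : ℂ) *
    ((Polynomial.C (u 0 0) * Polynomial.X + Polynomial.C (u 1 0)) ^ r *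
      (Polynomial.C (u 0 1) * Polynomial.X + Polynomial.C (u 1 1)) ^ (K - r)).coeff s

/-- The canonical basis vector `|k, m⟩` of the principal series representation `(N, ρ)`, for
`K = 2k ≥ N`, `K ≡ N` mod 2 and `r = k + m`.  On a unit vector `z` it equals
`√(2k+1) * D^k_{N/2, m}(u)`, with `u ∈ SU(2)` the matrix whose second row is `z`; it is extended to
`ℂ² ∖ {0}` by homogeneity. -/
noncomputable def canonicalVector (N : ℕ) (ρ : ℝ) (K r : ℕ) : (Fin 2 → ℂ) → ℂ := fun z =>
  (Real.sqrt (K + 1) : ℂ) *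
    ((Complex.normSq (z 0) + Complex.normSq (z 1) : ℝ) : ℂ) ^
      ((Complex.I * (ρ : ℂ) - 2 - (K : ℂ)) / 2) *
    wignerD K ((K + N) / 2) r
      !![(starRingEnd ℂ) (z 1), -(starRingEnd ℂ) (z 0); z 0, z 1]

/-- The matrix element `D^{N,ρ}_{k m, k' m'}(a) = ⟨k, m | D(a) | k', m'⟩` in the canonical basis,
with `K = 2k`, `K' = 2k'`. -/
noncomputable def principalMatrixElement (N : ℕ) (ρ : ℝ) (K K' : ℕ)
    (m : Fin (K + 1)) (m' : Fin (K' + 1)) (a : SL2C) : ℂ :=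
  principalInner (canonicalVector N ρ K m) (principalAction a (canonicalVector N ρ K' m'))

/-! ### Projected spin networks on the boundary graph of a 4-simplex

The nodes are the tetrahedra `t : Fin 5`, the links are the triangles `(t t')`, one for each
unordered pair of distinct tetrahedra. -/

/-- The labels of a projected spin network on the boundary graph of a 4-simplex, together with an
orientation of its ten links. -/
structure VertexLabels where
  /-- The oriented links `(source, target)`. -/
  links : Finset (Fin 5 × Fin 5)
  links_ne : ∀ p ∈ links, p.1 ≠ p.2
  links_orient : ∀ t t' : Fin 5, t ≠ t' → ((t, t') ∈ links ↔ (t', t) ∉ links)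
  /-- The discrete label of the principal series representation on a link. -/
  N : Sym2 (Fin 5) → ℕ
  /-- The continuous label of the principal series representation on a link. -/
  ρ : Sym2 (Fin 5) → ℝ
  /-- Twice the spin `k_{t t'} ∈ N_{(t t')}/2 + ℕ` attached to the node `t` and the link `(t t')`. -/
  twoK : Fin 5 → Fin 5 → ℕ
  le_twoK : ∀ t t' : Fin 5, t ≠ t' → N s(t, t') ≤ twoK t t'
  twoK_mod : ∀ t t' : Fin 5, t ≠ t' → twoK t t' % 2 = N s(t, t') % 2
  /-- The components, in the canonical bases, of a tensor among the four spins at each node.  It may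
  be any tensor, in particular any `SU(2)` intertwiner. -/
  tensor : (t : Fin 5) → ((t' : {t' : Fin 5 // t' ≠ t}) → Fin (twoK t t' + 1)) → ℂ

namespace VertexLabels

/-- The projected spin network as a function of the group elements `U t t'` on the links: the
contraction of the tensors at the nodes with the matrix elements on the links, the row index sitting
at the source and the column index at the target. -/
noncomputable def spinNetwork (L : VertexLabels) (U : Fin 5 → Fin 5 → SL2C) : ℂ :=
  ∑ m : (t : Fin 5) → (t' : {t' : Fin 5 // t' ≠ t}) → Fin (L.twoK t t' + 1),
    (∏ t : Fin 5, L.tensor t (m t)) *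
      ∏ p : {p : Fin 5 × Fin 5 // p ∈ L.links},
        principalMatrixElement (L.N s(p.1.1, p.1.2)) (L.ρ s(p.1.1, p.1.2))
          (L.twoK p.1.1 p.1.2) (L.twoK p.1.2 p.1.1)
          (m p.1.1 ⟨p.1.2, (L.links_ne p.1 p.2).symm⟩)
          (m p.1.2 ⟨p.1.1, L.links_ne p.1 p.2⟩)
          (U p.1.1 p.1.2)

/-- The integrand of the vertex amplitude, a function of the five group variables. -/
noncomputable def integrand (L : VertexLabels) (V : Fin 5 → SL2C) : ℂ :=
  L.spinNetwork fun t t' => (V t)⁻¹ * V t'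

end VertexLabels

/-- The five group variables with `V a = g`, the other four being given by `W`. -/
def insertVariable (a : Fin 5) (g : SL2C) (W : {j : Fin 5 // j ≠ a} → SL2C) : Fin 5 → SL2C :=
  fun j => if h : j = a then g else W ⟨j, h⟩

/-- The group elements on the links after the change of variables that eliminates `V a`:
`(W t)⁻¹ * W t'` on a link that avoids `a`, and `W t'` resp. `(W t)⁻¹` on a link with source
resp. target `a`. -/
def reducedLinks (a : Fin 5) (W : {j : Fin 5 // j ≠ a} → SL2C) (t t' : Fin 5) : SL2C :=
  if h : t = a then
    if h' : t' = a then 1 else W ⟨t', h'⟩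
  else
    if h' : t' = a then (W ⟨t, h⟩)⁻¹ else (W ⟨t, h⟩)⁻¹ * W ⟨t', h'⟩

namespace VertexLabels

/-- The integrand with `V a = g` held fixed, as a function of the four other group variables. -/
noncomputable def slice (L : VertexLabels) (a : Fin 5) (g : SL2C)
    (W : {j : Fin 5 // j ≠ a} → SL2C) : ℂ :=
  L.integrand (insertVariable a g W)

/-- The regularized vertex amplitude: the integral over the four group variables other than `V a`,
with `V a = g` held fixed. -/
noncomputable def regularizedVertex [MeasurableSpace SL2C] (L : VertexLabels) (μ : Measure SL2C)
    (a : Fin 5) (g : SL2C) : ℂ :=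
  ∫ W, L.slice a g W ∂(Measure.pi fun _ : {j : Fin 5 // j ≠ a} => μ)

end VertexLabels

/-! ### `SL(2,ℂ)` as a locally compact unimodular group -/

/-! The integrand sees only the products `(V t)⁻¹ * V t'`, so it is constant along the diagonal left
action of the group. In the coordinates `V a` and `(V a)⁻¹ * V j` it does not involve `V a` at all,
and by left invariance these coordinates preserve the product measure
(`measurePreserving_pi_insert_mul`). The five-fold integral is thus the volume of the `V a` region
times the four-fold integral, and noncompactness makes the total volume infinite.

Changing the value of the fixed variable needs only left translations. Moving from `V a` to `V b`
replaces one relative variable by its inverse and translates the others by it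
(`measurePreserving_pi_inv_mul`), which needs a measure invariant under inversion. This follows from
unimodularity: the group is perfect, so its modular character, having commutative target, is
trivial.

What remains is measurability of the matrix elements; their convergence properties play no role. -/

instance : SecondCountableTopology SL2C :=
  have : SecondCountableTopology (Matrix (Fin 2) (Fin 2) ℂ) :=
    inferInstanceAs (SecondCountableTopology (Fin 2 → Fin 2 → ℂ))
  (Matrix.SpecialLinearGroup.isClosedEmbedding_val (n := Fin 2)
    (R := ℂ)).isEmbedding.secondCountableTopology

instance : LocallyCompactSpace SL2C :=
  have : LocallyCompactSpace (Matrix (Fin 2) (Fin 2) ℂ) :=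
    inferInstanceAs (LocallyCompactSpace (Fin 2 → Fin 2 → ℂ))
  (Matrix.SpecialLinearGroup.isClosedEmbedding_val (n := Fin 2) (R := ℂ)).locallyCompactSpace

instance : NoncompactSpace SL2C := by
  refine ⟨fun hc => ?_⟩
  -- The upper right entry is unbounded, as transvections show: the entry `|C| + 1` exceeds any
  -- proposed bound `C`.
  have hcont : Continuous fun a : SL2C => ‖a 0 1‖ := by fun_prop
  obtain ⟨C, hC⟩ := (hc.image hcont).bddAbove
  have h := hC ⟨Matrix.SpecialLinearGroup.transvection (zero_ne_one (α := Fin 2)) ((|C| + 1 : ℝ) : ℂ),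
    Set.mem_univ _, rfl⟩
  simp only [Matrix.SpecialLinearGroup.transvection_coe] at h
  simp at h
  rw [← Complex.ofReal_one, ← Complex.ofReal_add, Complex.norm_real, Real.norm_eq_abs] at h
  linarith [le_abs_self C, le_abs_self (|C| + 1)]

namespace MeasureTheory.Measure

section Unimodular

variable {G : Type*} [Group G] [TopologicalSpace G] [IsTopologicalGroup G] [LocallyCompactSpace G]
  [SecondCountableTopology G] [MeasurableSpace G] [BorelSpace G]

/-- A Haar measure on a perfect group is right invariant. -/
theorem isMulRightInvariant_of_isPerfect [Group.IsPerfect G] (μ : Measure G) [μ.IsHaarMeasure] :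
    μ.IsMulRightInvariant := by
  refine ⟨fun g => ?_⟩
  -- Passing to units makes the target an abelian group, so the kernel contains all commutators.
  have hker : commutator G ≤ (modularCharacter (G := G)).toHomUnits.ker :=
    Abelianization.commutator_subset_ker _
  rw [Group.IsPerfect.commutator_eq_top] at hker
  have hg : modularCharacterFun g = 1 :=
    congrArg Units.val (MonoidHom.mem_ker.mp (hker (Subgroup.mem_top g)))
  rw [modularCharacterFun_eq_haarScalarFactor μ] at hg
  rw [isMulLeftInvariant_eq_smul (map (· * g) μ) μ, hg, one_smul]

/-- A right invariant Haar measure is invariant under inversion. -/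
theorem isInvInvariant_of_isMulRightInvariant (μ : Measure G) [μ.IsHaarMeasure]
    [μ.IsMulRightInvariant] : μ.IsInvInvariant := by
  constructor
  -- Right invariance of `μ` makes `μ.inv` left invariant, so uniqueness gives `μ.inv = c • μ`.
  -- Inverting twice yields `c ^ 2 = 1`, once the finite positive measure of a compact set with
  -- nonempty interior is cancelled.
  let c : ENNReal := haarScalarFactor μ.inv μ
  have hc : μ.inv = c • μ := isMulLeftInvariant_eq_smul μ.inv μ
  have hinv : μ = c ^ 2 • μ := by
    conv_lhs => rw [← Measure.inv_inv μ]
    rw [hc, inv_def, Measure.map_smul, ← inv_def, hc, smul_smul, pow_two]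
  have K : TopologicalSpace.PositiveCompacts G := Classical.arbitrary _
  have hK : c ^ 2 * μ K = 1 ^ 2 * μ K := by
    conv_rhs => rw [hinv]
    simp
  have hsq : c ^ 2 = 1 ^ 2 :=
    (ENNReal.mul_left_inj (measure_pos_of_nonempty_interior _ K.interior_nonempty).ne'
      K.isCompact.measure_lt_top.ne).1 hK
  have hone : c = 1 := (ENNReal.pow_right_strictMono two_ne_zero).injective hsq
  rw [hc, hone, one_smul]

end Unimodular

end MeasureTheory.Measure

/-- The commutator of `diag(a, a⁻¹)` with a transvection is a transvection whose parameter is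
multiplied by `a ^ 2 - 1` (up to inverting `a`). With `a = 2` all transvections arise, and they
generate. -/
instance : Group.IsPerfect SL2C :=
  ⟨Matrix.SL2.commutator_eq_top (a := (2 : ℂ)) (by norm_num) (by norm_num)⟩

/-! ### Changes of variables on finite products of a group -/

namespace MeasureTheory

variable {ι G : Type*} [Fintype ι] [DecidableEq ι] [MeasurableSpace G]

/-- Adjoining a coordinate `i` to the coordinates other than `i` is measure preserving. -/
theorem measurePreserving_pi_insert (μ : Measure G) [SigmaFinite μ] (i : ι) :
    MeasurePreserving
      (fun (p : G × ({j : ι // j ≠ i} → G)) (j : ι) => if h : j = i then p.1 else p.2 ⟨j, h⟩)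
      (μ.prod (Measure.pi fun _ => μ)) (Measure.pi fun _ : ι => μ) := by
  have hm : Measurable fun (p : G × ({j : ι // j ≠ i} → G)) (j : ι) =>
      if h : j = i then p.1 else p.2 ⟨j, h⟩ := by
    refine measurable_pi_lambda _ fun j => ?_
    by_cases h : j = i
    · simpa [h] using measurable_fst
    · simp only [h, dite_false]
      exact (measurable_pi_apply _).comp measurable_snd
  refine ⟨hm, (Measure.pi_eq fun s hs => ?_).symm⟩
  rw [Measure.map_apply hm (MeasurableSet.univ_pi hs)]
  have hpre : (fun (p : G × ({j : ι // j ≠ i} → G)) (j : ι) =>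
      if h : j = i then p.1 else p.2 ⟨j, h⟩) ⁻¹' Set.univ.pi s =
      s i ×ˢ Set.univ.pi fun j : {j : ι // j ≠ i} => s j := by
    ext p
    simp only [Set.mem_preimage, Set.mem_pi, Set.mem_univ, true_implies, Set.mem_prod]
    refine ⟨fun h => ⟨by simpa using h i, fun j => by simpa [j.2] using h j⟩, fun h j => ?_⟩
    by_cases hj : j = i
    · subst hj; simpa using h.1
    · simpa [hj] using h.2 ⟨j, hj⟩
  rw [hpre, Measure.prod_prod, Measure.pi_pi, Fintype.prod_eq_mul_prod_subtype_ne _ i]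

omit [DecidableEq ι] in
/-- Permuting the coordinates of a power of a measure space is measure preserving. -/
theorem measurePreserving_pi_reindex {ι' : Type*} [Fintype ι'] (μ : Measure G) [SigmaFinite μ]
    (e : ι' ≃ ι) :
    MeasurePreserving (fun (W : ι → G) (j : ι') => W (e j))
      (Measure.pi fun _ : ι => μ) (Measure.pi fun _ : ι' => μ) := by
  have hm : Measurable fun (W : ι → G) (j : ι') => W (e j) := by fun_prop
  refine ⟨hm, (Measure.pi_eq fun s hs => ?_).symm⟩
  rw [Measure.map_apply hm (MeasurableSet.univ_pi hs)]
  have hpre : (fun (W : ι → G) (j : ι') => W (e j)) ⁻¹' Set.univ.pi s =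
      Set.univ.pi fun j => s (e.symm j) := by
    ext W
    simp only [Set.mem_preimage, Set.mem_pi, Set.mem_univ, true_implies]
    exact ⟨fun h j => by simpa using h (e.symm j), fun h j => by simpa using h (e j)⟩
  rw [hpre, Measure.pi_pi]
  exact e.symm.prod_comp fun j => μ (s j)

variable [Group G] [MeasurableMul₂ G] [MeasurableInv G]

omit [MeasurableInv G] in
/-- Left translation of the coordinates other than `i` by the coordinate `i` is measure
preserving. -/
theorem measurePreserving_pi_insert_mul (μ : Measure G) [SigmaFinite μ] [μ.IsMulLeftInvariant]
    (i : ι) :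
    MeasurePreserving
      (fun (p : G × ({j : ι // j ≠ i} → G)) (j : ι) =>
        if h : j = i then p.1 else p.1 * p.2 ⟨j, h⟩)
      (μ.prod (Measure.pi fun _ => μ)) (Measure.pi fun _ : ι => μ) := by
  -- A shear over the coordinate `i`: on each fibre it is a left translation of the remaining
  -- coordinates.
  refine (measurePreserving_pi_insert μ i).comp
    ((MeasurePreserving.id μ).skew_product (g := fun x (W : {j : ι // j ≠ i} → G) j => x * W j) ?_
      (Filter.Eventually.of_forall fun x => ?_))
  · exact measurable_pi_lambda _ fun j =>
      measurable_fst.mul ((measurable_pi_apply j).comp measurable_snd)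
  · exact map_mul_left_eq_self (Measure.pi fun _ : {j : ι // j ≠ i} => μ) fun _ => x

/-- Inverting the coordinate `i`, and translating all others by that inverse, is measure
preserving. -/
theorem measurePreserving_pi_inv_mul (μ : Measure G) [SigmaFinite μ] [μ.IsMulLeftInvariant]
    [μ.IsInvInvariant] (i : ι) :
    MeasurePreserving (fun (W : ι → G) (j : ι) => if j = i then (W i)⁻¹ else (W i)⁻¹ * W j)
      (Measure.pi fun _ : ι => μ) (Measure.pi fun _ : ι => μ) := by
  -- Splitting off the coordinate `i` conjugates the map to `(x, W) ↦ (x⁻¹, x⁻¹ * W)`: inversion on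
  -- the base, a left translation on each fibre.
  refine (measurePreserving_pi_insert μ i).of_semiconj
    (ga := fun p : G × ({j : ι // j ≠ i} → G) => (p.1⁻¹, fun j => p.1⁻¹ * p.2 j)) ?_ (fun p => ?_) ?_
  · refine (Measure.measurePreserving_inv μ).skew_product (g := fun x (W : {j : ι // j ≠ i} → G) j => x⁻¹ * W j) ?_
      (Filter.Eventually.of_forall fun x => ?_)
    · exact measurable_pi_lambda _ fun j =>
        measurable_fst.inv.mul ((measurable_pi_apply j).comp measurable_snd)
    · exact map_mul_left_eq_self (Measure.pi fun _ : {j : ι // j ≠ i} => μ) fun _ => x⁻¹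
  · ext j
    by_cases h : j = i <;> simp [h]
  · refine measurable_pi_lambda _ fun j => ?_
    by_cases h : j = i
    · simp only [h, if_true]
      exact (measurable_pi_apply i).inv
    · simp only [h, if_false]
      exact (measurable_pi_apply i).inv.mul (measurable_pi_apply j)

end MeasureTheory

/-! ### Measurability of the integrand -/

theorem Polynomial.measurable_coeff_mul {α R : Type*} [MeasurableSpace α] [Semiring R]
    [MeasurableSpace R] [MeasurableMul₂ R] [MeasurableAdd₂ R] {p q : α → Polynomial R}
    (hp : ∀ n, Measurable fun x => (p x).coeff n) (hq : ∀ n, Measurable fun x => (q x).coeff n)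
    (n : ℕ) : Measurable fun x => (p x * q x).coeff n := by
  simp only [Polynomial.coeff_mul]
  exact Finset.measurable_fun_sum _ fun i _ => (hp i.1).mul (hq i.2)

theorem Polynomial.measurable_coeff_pow {α R : Type*} [MeasurableSpace α] [Semiring R]
    [MeasurableSpace R] [MeasurableMul₂ R] [MeasurableAdd₂ R] {p : α → Polynomial R}
    (hp : ∀ n, Measurable fun x => (p x).coeff n) (r n : ℕ) :
    Measurable fun x => (p x ^ r).coeff n := by
  induction r generalizing n with
  | zero => simp
  | succ r ih =>
    simp only [pow_succ]
    exact Polynomial.measurable_coeff_mul ih hp n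

theorem Polynomial.measurable_coeff_C_mul_X_add_C {α R : Type*} [MeasurableSpace α] [Semiring R]
    [MeasurableSpace R] [MeasurableMul₂ R] [MeasurableAdd₂ R] {a b : α → R} (ha : Measurable a)
    (hb : Measurable b) (n : ℕ) :
    Measurable fun x => (Polynomial.C (a x) * Polynomial.X + Polynomial.C (b x)).coeff n := by
  simp only [Polynomial.coeff_add, Polynomial.coeff_C_mul, Polynomial.coeff_C]
  refine (ha.mul_const _).add ?_
  split_ifs
  exacts [hb, measurable_const]

theorem measurable_wignerD {α : Type*} [MeasurableSpace α] (K s r : ℕ)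
    {u : α → Matrix (Fin 2) (Fin 2) ℂ} (hu : ∀ i j, Measurable fun x => u x i j) :
    Measurable fun x => wignerD K s r (u x) :=
  measurable_const.mul (Polynomial.measurable_coeff_mul
    (Polynomial.measurable_coeff_pow
      (Polynomial.measurable_coeff_C_mul_X_add_C (hu 0 0) (hu 1 0)) r)
    (Polynomial.measurable_coeff_pow
      (Polynomial.measurable_coeff_C_mul_X_add_C (hu 0 1) (hu 1 1)) (K - r)) s)

theorem measurable_canonicalVector (N : ℕ) (ρ : ℝ) (K r : ℕ) :
    Measurable (canonicalVector N ρ K r) := by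
  have h0 : Measurable fun z : Fin 2 → ℂ => z 0 := measurable_pi_apply 0
  have h1 : Measurable fun z : Fin 2 → ℂ => z 1 := measurable_pi_apply 1
  refine (measurable_const.mul (Measurable.pow_const ?_ _)).mul (measurable_wignerD K _ r ?_)
  · exact Complex.measurable_ofReal.comp
      ((Complex.continuous_normSq.measurable.comp h0).add
        (Complex.continuous_normSq.measurable.comp h1))
  · intro i j
    fin_cases i <;> fin_cases j
    · exact Complex.continuous_conj.measurable.comp h1
    · exact (Complex.continuous_conj.measurable.comp h0).neg
    · exact h0
    · exact h1

section Integrand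

variable [MeasurableSpace SL2C] [BorelSpace SL2C]

/-- A parameter integral of a jointly measurable function is measurable, whether or not it converges
for each parameter. -/
theorem measurable_principalMatrixElement (N : ℕ) (ρ : ℝ) (K K' : ℕ) (m : Fin (K + 1))
    (m' : Fin (K' + 1)) : Measurable (principalMatrixElement N ρ K K' m m') := by
  have hentry (i j : Fin 2) : Measurable fun p : SL2C × ℂ => p.1 i j :=
    Measurable.comp (g := fun a : SL2C => a i j)
      (Continuous.measurable (by fun_prop)) measurable_fst
  have hw : Measurable fun p : SL2C × ℂ => ![p.2, 1] := by
    refine measurable_pi_lambda _ fun i => ?_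
    fin_cases i
    exacts [measurable_snd, measurable_const]
  have hact : Measurable fun p : SL2C × ℂ =>
      ![p.2, 1] ᵥ* (p.1 : Matrix (Fin 2) (Fin 2) ℂ) := by
    refine measurable_pi_lambda _ fun j => ?_
    simp only [Matrix.vecMul, dotProduct]
    exact Finset.measurable_fun_sum _ fun i _ => ((measurable_pi_apply i).comp hw).mul (hentry i j)
  have hjoint : Measurable fun p : SL2C × ℂ =>
      (starRingEnd ℂ) (canonicalVector N ρ K m ![p.2, 1]) *
        principalAction p.1 (canonicalVector N ρ K' m') ![p.2, 1] :=
    (Complex.continuous_conj.measurable.comp ((measurable_canonicalVector N ρ K m).comp hw)).mul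
      ((measurable_canonicalVector N ρ K' m').comp hact)
  exact measurable_const.mul hjoint.stronglyMeasurable.integral_prod_right.measurable

namespace VertexLabels

variable (L : VertexLabels)

theorem measurable_integrand : Measurable L.integrand := by
  refine Finset.measurable_fun_sum _ fun m _ => measurable_const.mul ?_
  refine Finset.measurable_fun_prod _ fun p _ =>
    (measurable_principalMatrixElement _ _ _ _ _ _).comp ?_
  exact (measurable_pi_apply _).inv.mul (measurable_pi_apply _)

theorem measurable_slice (a : Fin 5) (g : SL2C) : Measurable (L.slice a g) := by
  refine L.measurable_integrand.comp (measurable_pi_lambda _ fun j => ?_)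
  by_cases h : j = a
  · simp [insertVariable, h]
  · simpa [insertVariable, h] using measurable_pi_apply _

end VertexLabels

end Integrand

namespace VertexLabels

variable (L : VertexLabels)

/-! ### Invariance of the integrand -/

theorem integrand_mul_left (g : SL2C) (V : Fin 5 → SL2C) :
    L.integrand (fun j => g * V j) = L.integrand V := by
  simp [integrand, mul_assoc]

theorem slice_mul_left (a : Fin 5) (x g : SL2C) (W : {j : Fin 5 // j ≠ a} → SL2C) :
    L.slice a (x * g) (fun j => x * W j) = L.slice a g W := by
  rw [slice, slice, ← L.integrand_mul_left x (insertVariable a g W)]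
  congr 1
  ext1 j
  by_cases h : j = a <;> simp [insertVariable, h]

theorem slice_one (a : Fin 5) (W : {j : Fin 5 // j ≠ a} → SL2C) :
    L.slice a 1 W = L.spinNetwork (reducedLinks a W) := by
  rw [slice, integrand]
  congr 1
  ext1 t
  ext1 t'
  by_cases h : t = a <;> by_cases h' : t' = a <;> simp [insertVariable, reducedLinks, h, h']

variable [MeasurableSpace SL2C] [BorelSpace SL2C]

/-- Passing from `V a = g` to `V b = h` is a measure preserving change of the other variables. -/
theorem exists_measurePreserving_slice (μ : Measure SL2C) [μ.IsHaarMeasure] [μ.IsInvInvariant]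
    (a b : Fin 5) (g h : SL2C) :
    ∃ Φ : ({j : Fin 5 // j ≠ a} → SL2C) → ({j : Fin 5 // j ≠ b} → SL2C),
      MeasurePreserving Φ (Measure.pi fun _ => μ) (Measure.pi fun _ => μ) ∧
        ∀ W, L.slice b h (Φ W) = L.slice a g W := by
  have hmul (c : Fin 5) (x : SL2C) :
      MeasurePreserving (fun (W : {j : Fin 5 // j ≠ c} → SL2C) j => x * W j)
        (Measure.pi fun _ => μ) (Measure.pi fun _ => μ) :=
    measurePreserving_mul_left (Measure.pi fun _ : {j : Fin 5 // j ≠ c} => μ) fun _ => x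
  by_cases hab : a = b
  · subst hab
    refine ⟨_, hmul a (h * g⁻¹), fun W => ?_⟩
    rw [← L.slice_mul_left a (h * g⁻¹) g W, inv_mul_cancel_right]
  -- The slot `b`, freed when `V b` becomes the fixed variable, is reused for `V a`.
  · let e : {j : Fin 5 // j ≠ b} ≃ {j : Fin 5 // j ≠ a} :=
      (Equiv.swap a b).subtypeEquiv fun j => not_congr <| by
        rw [Equiv.swap_apply_eq_iff, Equiv.swap_apply_left]
    let b' : {j : Fin 5 // j ≠ a} := ⟨b, Ne.symm hab⟩
    -- Read from the right: normalize `V a` to `1`, translate so that `V b` becomes `1` (which puts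
    -- the inverse of the old `V b` at `a`), rename the slot, and move `V b` from `1` to `h`.
    -- Altogether this is the diagonal translation by `h * (g⁻¹ * W b')⁻¹ * g⁻¹`.
    refine ⟨_, (hmul b h).comp ((measurePreserving_pi_reindex μ e).comp
      ((measurePreserving_pi_inv_mul μ b').comp (hmul a g⁻¹))), fun W => ?_⟩
    rw [slice, slice,
      ← L.integrand_mul_left (h * (g⁻¹ * W b')⁻¹ * g⁻¹) (insertVariable a g W)]
    congr 1
    ext1 j
    by_cases hb : j = b
    · subst hb
      simp [insertVariable, Ne.symm hab, b', mul_assoc]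
    · by_cases ha : j = a
      · subst ha
        have he : e ⟨j, hab⟩ = b' := Subtype.ext (Equiv.swap_apply_left j b)
        simp [insertVariable, hab, he, b']
      · have he : e ⟨j, hb⟩ = ⟨j, ha⟩ := Subtype.ext (Equiv.swap_apply_of_ne_of_ne ha hb)
        have hne : (⟨j, ha⟩ : {j : Fin 5 // j ≠ a}) ≠ b' := fun h => hb (congrArg Subtype.val h)
        simp [insertVariable, ha, hb, he, hne, mul_assoc]

omit [MeasurableSpace SL2C] [BorelSpace SL2C] in
/-- The coordinates `V a` and `(V a)⁻¹ * V j` on the domain of the integrand. -/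
theorem integrand_insert_mul (a : Fin 5) (p : SL2C × ({j : Fin 5 // j ≠ a} → SL2C)) :
    L.integrand (fun j => if h : j = a then p.1 else p.1 * p.2 ⟨j, h⟩) = L.slice a 1 p.2 := by
  rw [← L.slice_mul_left a p.1 1 p.2, mul_one]
  rfl

/-! ### Factorization of the five-fold integral -/

section

variable (μ : Measure SL2C) [μ.IsHaarMeasure]

/-- Tonelli in the sheared coordinates, where the integrand ignores the first variable; no
finiteness is needed. -/
theorem lintegral_enorm_integrand (a : Fin 5) :
    ∫⁻ V, ‖L.integrand V‖ₑ ∂(Measure.pi fun _ : Fin 5 => μ) =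
      μ Set.univ * ∫⁻ W, ‖L.slice a 1 W‖ₑ ∂(Measure.pi fun _ : {j : Fin 5 // j ≠ a} => μ) := by
  rw [← (measurePreserving_pi_insert_mul μ a).lintegral_comp L.measurable_integrand.enorm]
  simp only [integrand_insert_mul]
  rw [lintegral_prod (fun p : SL2C × ({j : Fin 5 // j ≠ a} → SL2C) => ‖L.slice a 1 p.2‖ₑ)
    ((L.measurable_slice a 1).enorm.comp measurable_snd).aemeasurable]
  simp [mul_comm]

/-- The shear leaves the coordinate `a` alone, so the constraint `V a ∈ S` pulls back to the product
set `S ×ˢ Set.univ`. -/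
theorem measurePreserving_restrict_insert_mul (a : Fin 5) {S : Set SL2C} (hS : MeasurableSet S) :
    MeasurePreserving
      (fun (p : SL2C × ({j : Fin 5 // j ≠ a} → SL2C)) (j : Fin 5) =>
        if h : j = a then p.1 else p.1 * p.2 ⟨j, h⟩)
      ((μ.restrict S).prod (Measure.pi fun _ => μ))
      ((Measure.pi fun _ : Fin 5 => μ).restrict {V | V a ∈ S}) := by
  have h := (measurePreserving_pi_insert_mul μ a).restrict_preimage
    (s := {V : Fin 5 → SL2C | V a ∈ S}) (measurable_pi_apply a hS)
  have hpre : (fun (p : SL2C × ({j : Fin 5 // j ≠ a} → SL2C)) (j : Fin 5) =>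
      if h : j = a then p.1 else p.1 * p.2 ⟨j, h⟩) ⁻¹' {V | V a ∈ S} = S ×ˢ Set.univ := by
    ext p
    simp
  rwa [hpre, ← Measure.prod_restrict, Measure.restrict_univ] at h

theorem integrableOn_integrand (a : Fin 5) {S : Set SL2C} (hS : MeasurableSet S) (hμS : μ S ≠ ⊤)
    (hL : Integrable (L.slice a 1) (Measure.pi fun _ : {j : Fin 5 // j ≠ a} => μ)) :
    IntegrableOn L.integrand {V | V a ∈ S} (Measure.pi fun _ : Fin 5 => μ) := by
  have : IsFiniteMeasure (μ.restrict S) := ⟨by simpa using hμS.lt_top⟩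
  rw [IntegrableOn, ← (measurePreserving_restrict_insert_mul μ a hS).integrable_comp
    L.measurable_integrand.aestronglyMeasurable]
  simpa only [Function.comp_def, integrand_insert_mul] using hL.comp_snd (μ.restrict S)

/-- Neither integrability nor `μ S ≠ ⊤` is required: default values agree on both sides, since
divergent integrals are `0` and `μ.real S = 0` when `μ S = ⊤`. -/
theorem setIntegral_integrand (a : Fin 5) {S : Set SL2C} (hS : MeasurableSet S) :
    ∫ V in {V | V a ∈ S}, L.integrand V ∂(Measure.pi fun _ : Fin 5 => μ) =
      (μ.real S : ℂ) * L.regularizedVertex μ a 1 := by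
  have h := measurePreserving_restrict_insert_mul μ a hS
  rw [← h.map_eq, integral_map h.measurable.aemeasurable
    L.measurable_integrand.aestronglyMeasurable]
  simp only [integrand_insert_mul]
  rw [integral_fun_snd (L.slice a 1)]
  simp [regularizedVertex]

end

/-! ### Independence of the fixed variable and of its value -/

section

variable (μ : Measure SL2C) [μ.IsHaarMeasure] [μ.IsInvInvariant] (a b : Fin 5) (g h : SL2C)

theorem integrable_slice_iff :
    Integrable (L.slice a g) (Measure.pi fun _ : {j : Fin 5 // j ≠ a} => μ) ↔
      Integrable (L.slice b h) (Measure.pi fun _ : {j : Fin 5 // j ≠ b} => μ) := by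
  obtain ⟨Φ, hΦ, hL⟩ := L.exists_measurePreserving_slice μ a b g h
  rw [← hΦ.integrable_comp (L.measurable_slice b h).aestronglyMeasurable]
  simp only [Function.comp_def, hL]

theorem lintegral_enorm_slice_eq :
    ∫⁻ W, ‖L.slice a g W‖ₑ ∂(Measure.pi fun _ : {j : Fin 5 // j ≠ a} => μ) =
      ∫⁻ W, ‖L.slice b h W‖ₑ ∂(Measure.pi fun _ : {j : Fin 5 // j ≠ b} => μ) := by
  obtain ⟨Φ, hΦ, hL⟩ := L.exists_measurePreserving_slice μ a b g h
  rw [← hΦ.lintegral_comp (L.measurable_slice b h).enorm]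
  simp only [hL]

theorem regularizedVertex_eq : L.regularizedVertex μ a g = L.regularizedVertex μ b h := by
  obtain ⟨Φ, hΦ, hL⟩ := L.exists_measurePreserving_slice μ a b g h
  rw [regularizedVertex, regularizedVertex, ← hΦ.map_eq,
    integral_map hΦ.measurable.aemeasurable (L.measurable_slice b h).aestronglyMeasurable]
  simp only [hL]

end

end VertexLabels

theorem mainTheorem7 [MeasurableSpace SL2C] [BorelSpace SL2C]
    (μ : Measure SL2C) [μ.IsHaarMeasure] (L : VertexLabels) :
    -- the Haar measure is right invariant and has infinite total volume
    μ.IsMulRightInvariant ∧ μ Set.univ = ⊤ ∧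
    -- absolute convergence of the four-fold integral depends neither on the value of the
    -- fixed variable nor on which variable is fixed
    (∀ (a b : Fin 5) (g h : SL2C),
      Integrable (L.slice a g) (Measure.pi fun _ : {j : Fin 5 // j ≠ a} => μ) ↔
        Integrable (L.slice b h) (Measure.pi fun _ : {j : Fin 5 // j ≠ b} => μ)) ∧
    (∀ (a b : Fin 5) (g h : SL2C),
      ∫⁻ W, ‖L.slice a g W‖ₑ ∂(Measure.pi fun _ : {j : Fin 5 // j ≠ a} => μ) =
        ∫⁻ W, ‖L.slice b h W‖ₑ ∂(Measure.pi fun _ : {j : Fin 5 // j ≠ b} => μ)) ∧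
    -- the same holds for the value of the four-fold integral
    (∀ (a : Fin 5) (g h : SL2C), L.regularizedVertex μ a g = L.regularizedVertex μ a h) ∧
    (∀ (a b : Fin 5) (g h : SL2C), L.regularizedVertex μ a g = L.regularizedVertex μ b h) ∧
    -- the simplified form, in which the fixed variable does not occur
    (∀ (a : Fin 5) (g : SL2C), L.regularizedVertex μ a g =
      ∫ W, L.spinNetwork (reducedLinks a W) ∂(Measure.pi fun _ : {j : Fin 5 // j ≠ a} => μ)) ∧
    -- the five-fold integral: restricting the last variable to `S` gives the factor `μ S`
    (∀ (a : Fin 5) (g : SL2C) (S : Set SL2C), MeasurableSet S → μ S ≠ ⊤ →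
      (Integrable (L.slice a g) (Measure.pi fun _ : {j : Fin 5 // j ≠ a} => μ) →
        IntegrableOn L.integrand {V | V a ∈ S} (Measure.pi fun _ : Fin 5 => μ)) ∧
      ∫ V in {V | V a ∈ S}, L.integrand V ∂(Measure.pi fun _ : Fin 5 => μ) =
        (μ.real S : ℂ) * L.regularizedVertex μ a g) ∧
    -- the unrestricted five-fold integral carries the factor `μ univ`, hence diverges
    (∀ (a : Fin 5) (g : SL2C),
      ∫⁻ V, ‖L.integrand V‖ₑ ∂(Measure.pi fun _ : Fin 5 => μ) =
        μ Set.univ * ∫⁻ W, ‖L.slice a g W‖ₑ ∂(Measure.pi fun _ : {j : Fin 5 // j ≠ a} => μ)) ∧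
    (∀ (a : Fin 5) (g : SL2C), L.regularizedVertex μ a g ≠ 0 →
      ¬ Integrable L.integrand (Measure.pi fun _ : Fin 5 => μ)) := by
  have hright : μ.IsMulRightInvariant := Measure.isMulRightInvariant_of_isPerfect μ
  have hinv : μ.IsInvInvariant := Measure.isInvInvariant_of_isMulRightInvariant μ
  have huniv : μ Set.univ = ⊤ := measure_univ_of_isMulLeftInvariant μ
  have hfull (a : Fin 5) (g : SL2C) :
      ∫⁻ V, ‖L.integrand V‖ₑ ∂(Measure.pi fun _ : Fin 5 => μ) =
        μ Set.univ * ∫⁻ W, ‖L.slice a g W‖ₑ ∂(Measure.pi fun _ : {j : Fin 5 // j ≠ a} => μ) := by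
    rw [L.lintegral_enorm_integrand μ a, L.lintegral_enorm_slice_eq μ a a 1 g]
  refine ⟨hright, huniv, L.integrable_slice_iff μ, L.lintegral_enorm_slice_eq μ,
    fun a => L.regularizedVertex_eq μ a a, L.regularizedVertex_eq μ, fun a g => ?_,
    fun a g S hS hμS => ⟨fun hL => ?_, ?_⟩, hfull, fun a g hne hint => hne ?_⟩
  · rw [L.regularizedVertex_eq μ a a g 1]
    simp only [VertexLabels.regularizedVertex, VertexLabels.slice_one]
  · exact L.integrableOn_integrand μ a hS hμS ((L.integrable_slice_iff μ a a g 1).1 hL)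
  · rw [L.setIntegral_integrand μ a hS, L.regularizedVertex_eq μ a a g 1]
  -- Finiteness of `⊤` times the four-fold integral of the norm forces the latter to vanish; the
  -- slice is then zero almost everywhere, and so is its integral.
  · have hlt : ∫⁻ V, ‖L.integrand V‖ₑ ∂(Measure.pi fun _ : Fin 5 => μ) < ⊤ := hint.2
    rw [hfull a g, huniv] at hlt
    have hzero : ∫⁻ W, ‖L.slice a g W‖ₑ
        ∂(Measure.pi fun _ : {j : Fin 5 // j ≠ a} => μ) = 0 := by
      by_contra h
      simp [ENNReal.top_mul h] at hlt
    rw [lintegral_eq_zero_iff (L.measurable_slice a g).enorm] at hzero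
    refine integral_eq_zero_of_ae (hzero.mono fun W hW => ?_)
    simpa using hW
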